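/- Let $b$ and $m\ge 2$ be powers of $2$. For $k\in\{2,4,\dots,m\}$ (a power of $2$), a block butterfly factor of size $kb$ and block size $b$ is a real matrix $\begin{bmatrix}\mathbf D_1&\mathbf D_2\\ \mathbf D_3&\mathbf D_4\end{bmatrix}$ in which every $\mathbf D_i=\mathrm{diag}(D_{i,1},\dots,D_{i,k/2})$ is block diagonal with blocks $D_{i,j}\in\mathbb R^{b\times b}$; a block butterfly factor matrix $\mathbf B_k^{(m,b)}$ is a block diagonal $mb\times mb$ matrix of $m/k$ such factors; and a block butterfly matrix of size $mb$ with block size $b$ is a product $\mathbf B_m^{(m,b)}\mathbf B_{m/2}^{(m,b)}\cdots\mathbf B_2^{(m,b)}$. Its parameters are the entries of all blocks $D_{i,j}$ of all its factor matrices ($2mb^2\log_2 m$ in number). For every $b$ that is a power of $2$ there is a constant $C$ (depending only on $b$) such that the following holds. Let $n\ge 2$ and let $M$ be a real $nb\times nb$ matrix with exactly $s$ nonzero entries. Then there are a power of two $m$ with $n\le m\le 8n$ and a finite product $P$ of $mb\times mb$ block butterfly matrices of block size $b$ and transposes of such matrices such that: - $M$ is the leading $nb\times nb$ submatrix of $P$;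 moreover, if $n$ is a power of $2$ and $s\le nb$, one can take $m=n$, so that $M=P$; - the total number of parameters of the matrices in the product is at most $C\max(s,n)\log n$; in particular it is at most $C\,s\log n$ when $s\ge n$; - at most $C\,s\log n$ of these parameters are nonzero (for every $s\ge 0$). -/

import Mathlib

/-- The number of nonzero entries of a real matrix. -/
noncomputable def matrixNnz {ι κ : Type*} [Fintype ι] [Fintype κ] (M : Matrix ι κ ℝ) : ℕ :=
  Nat.card {e : ι × κ // M e.1 e.2 ≠ 0}

/-- The block butterfly factor `[[D₀₀, D₀₁], [D₁₀, D₁₁]]` of size `k b` with `k = 2 h` and block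
size `b`, where each `D p q` stands for the block diagonal matrix
`diag (D p q 0, …, D p q (h - 1))` of `b × b` blocks. A row (or column) has coordinates
(half, block within the half, position within the block). -/
def blockButterflyFactor {h b : ℕ} (D : Fin 2 → Fin 2 → Fin h → Matrix (Fin b) (Fin b) ℝ) :
    Matrix (Fin 2 × Fin h × Fin b) (Fin 2 × Fin h × Fin b) ℝ :=
  Matrix.of fun r c => if r.2.1 = c.2.1 then D r.1 c.1 r.2.1 r.2.2 c.2.2 else 0

/-- With `n = 2 ^ p` and stride `k = 2 ^ (l + 1)`, the block number
`t * k + a * (k / 2) + j` is identified with the triple `(t, a, j)`, where `t < n / k` is the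
diagonal factor it belongs to, `a < 2` the half of that factor and `j < k / 2` the place in that
half. -/
def strideEquiv {p : ℕ} (l : Fin p) :
    Fin (2 ^ (p - 1 - (l : ℕ))) × Fin 2 × Fin (2 ^ (l : ℕ)) ≃ Fin (2 ^ p) :=
  ((Equiv.prodCongr (Equiv.refl _) finProdFinEquiv).trans finProdFinEquiv).trans
    (finCongr (by
      rw [← pow_succ', ← pow_add]
      congr 1
      have := l.isLt
      omega))

/-- The block butterfly factor matrix of size `n b`, `n = 2 ^ p`, with stride `k = 2 ^ (l + 1)` and
block size `b`: the block diagonal matrix with the `n / k` block butterfly factors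
`blockButterflyFactor (D t)` of size `k b` on its diagonal. The index `(i, x)` is the row (or column)
`i * b + x` of the `n b × n b` matrix. -/
def blockButterflyFactorMatrix {p b : ℕ} (l : Fin p)
    (D : Fin (2 ^ (p - 1 - (l : ℕ))) →
      Fin 2 → Fin 2 → Fin (2 ^ (l : ℕ)) → Matrix (Fin b) (Fin b) ℝ) :
    Matrix (Fin (2 ^ p) × Fin b) (Fin (2 ^ p) × Fin b) ℝ :=
  Matrix.of fun r c =>
    let u := (strideEquiv l).symm r.1
    let v := (strideEquiv l).symm c.1
    if u.1 = v.1 then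
      blockButterflyFactor (D u.1) (u.2.1, u.2.2, r.2) (v.2.1, v.2.2, c.2)
    else 0

/-- The index set of the parameters of a block butterfly matrix of size `2 ^ p * b` with block size
`b`: all entries of all blocks `D t a c j` of all its factor matrices. -/
abbrev BlockButterflyIndex (p b : ℕ) : Type :=
  Σ l : Fin p, Fin (2 ^ (p - 1 - (l : ℕ))) × Fin 2 × Fin 2 × Fin (2 ^ (l : ℕ)) × Fin b × Fin b

/-- The block butterfly matrix `B_n B_{n/2} ⋯ B_4 B_2` of size `n b`, `n = 2 ^ p`, with block size
`b` and parameters `θ` (largest stride leftmost). -/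
def blockButterflyMatrix {p b : ℕ} (θ : BlockButterflyIndex p b → ℝ) :
    Matrix (Fin (2 ^ p) × Fin b) (Fin (2 ^ p) × Fin b) ℝ :=
  (List.ofFn fun i : Fin p =>
    blockButterflyFactorMatrix i.rev fun t a c j =>
      Matrix.of fun x y => θ ⟨i.rev, t, a, c, j, x, y⟩).prod

/-- The product of block butterfly matrices and transposes of such matrices given by a list of
parameter vectors, each marked with `true` if the matrix is to be transposed. -/
def blockButterflyProduct {p b : ℕ} (L : List (Bool × (BlockButterflyIndex p b → ℝ))) :
    Matrix (Fin (2 ^ p) × Fin b) (Fin (2 ^ p) × Fin b) ℝ :=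
  (L.map fun e =>
    if e.1 = true then (blockButterflyMatrix e.2).transpose else blockButterflyMatrix e.2).prod

/-- The number of all parameters of such a product. -/
def numParams {p b : ℕ} (L : List (Bool × (BlockButterflyIndex p b → ℝ))) : ℕ :=
  L.length * Fintype.card (BlockButterflyIndex p b)

/-- The number of nonzero parameters of such a product. -/
noncomputable def numNonzeroParams {p b : ℕ}
    (L : List (Bool × (BlockButterflyIndex p b → ℝ))) : ℕ :=
  (L.map fun e => Nat.card {i : BlockButterflyIndex p b // e.2 i ≠ 0}).sum

/-! ### Routing in a butterfly network -/

/-! A butterfly matrix is a switching network. From block `u` to block `v` there is one path, which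
replaces the binary digits of `u` by those of `v`, lowest digit first; the position inside a block
is switched freely in the first factor. If the paths `u k → v k` meet only when they share their end
(`Routable`), the 0-1 matrix of this map is one butterfly matrix, with at most one nonzero parameter
per path and factor.

Two kinds of maps are routed. A map that does not increase distances of positions is routable
(`routable_of_lipschitz`). A permutation goes through intermediate nodes from which both its source
and its target are routable (`exists_routable_pair`, the looping argument for Beneš networks), so it
is a butterfly matrix times a transposed one. An arbitrary map of few points is then a permutation
that sorts by target, a contraction that merges equal targets, and the transpose of a contraction,
which spreads the results: four factors (`hasButterflyProduct_routeMatrix`).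

If `M` has no more nonzero entries than rows, number these entries: `M` is (map to rows) · (diagonal
of values) · (map to columns)ᵀ, which takes 4 + 1 + 4 = 9 factors. Otherwise split `M` into about `s
/ (n * b)` such pieces and add them by multiplying unitriangular block matrices in a larger space
(`exists_prod_eq_sum`). -/

theorem matrixNnz_le_of_support {ι κ α : Type*} [Fintype ι] [Fintype κ] [Finite α]
    (M : Matrix ι κ ℝ) (f : α → ι × κ) (hf : ∀ r c, M r c ≠ 0 → ∃ k, f k = (r, c)) :
    matrixNnz M ≤ Nat.card α := by
  choose g hg using hf
  refine Nat.card_le_card_of_injective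
    (fun e : {e : ι × κ // M e.1 e.2 ≠ 0} => g e.1.1 e.1.2 e.2) fun e e' h => ?_
  have h1 := hg e.1.1 e.1.2 e.2
  have h2 := hg e'.1.1 e'.1.2 e'.2
  simp only at h
  rw [h, h2] at h1
  exact Subtype.ext h1.symm

theorem card_blockButterflyIndex (p b : ℕ) :
    Fintype.card (BlockButterflyIndex p b) = p * (2 ^ (p + 1) * b ^ 2) := by
  rw [Fintype.card_sigma]
  simp only [Fintype.card_prod, Fintype.card_fin]
  rw [Finset.sum_congr rfl (g := fun _ => 2 ^ (p + 1) * b ^ 2)]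
  · simp
  · intro l _
    have : 2 ^ (p + 1) = 2 ^ (p - 1 - (l : ℕ)) * 2 ^ (l : ℕ) * 4 := by
      rw [← pow_add, show (4 : ℕ) = 2 ^ 2 by norm_num, ← pow_add]
      congr 1
      have := l.isLt
      omega
    rw [this]
    ring

theorem strideEquiv_val {p : ℕ} (l : Fin p)
    (t : Fin (2 ^ (p - 1 - (l : ℕ)))) (a : Fin 2) (j : Fin (2 ^ (l : ℕ))) :
    (strideEquiv l (t, a, j) : ℕ) = j + 2 ^ (l : ℕ) * a + 2 ^ ((l : ℕ) + 1) * t := by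
  simp [strideEquiv, finProdFinEquiv, pow_succ']

/-- Two block numbers may be joined by an edge of the factor with stride `2 ^ (l + 1)`: they agree
in all binary digits except possibly digit `l`. -/
def StrideAdj (l i j : ℕ) : Prop :=
  i / 2 ^ (l + 1) = j / 2 ^ (l + 1) ∧ i % 2 ^ l = j % 2 ^ l

theorem strideAdj_iff {p : ℕ} (l : Fin p) (i j : Fin (2 ^ p)) :
    StrideAdj l i j ↔ ((strideEquiv l).symm i).1 = ((strideEquiv l).symm j).1 ∧
      ((strideEquiv l).symm i).2.2 = ((strideEquiv l).symm j).2.2 := by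
  obtain ⟨⟨t, a, x⟩, rfl⟩ := (strideEquiv l).surjective i
  obtain ⟨⟨t', a', x'⟩, rfl⟩ := (strideEquiv l).surjective j
  have key : ∀ (t : Fin (2 ^ (p - 1 - (l : ℕ)))) (a : Fin 2) (x : Fin (2 ^ (l : ℕ))),
      (strideEquiv l (t, a, x) : ℕ) / 2 ^ ((l : ℕ) + 1) = t ∧
        (strideEquiv l (t, a, x) : ℕ) % 2 ^ (l : ℕ) = x := by
    intro t a x
    rw [strideEquiv_val]
    constructor
    · rw [Nat.add_mul_div_left _ _ (by positivity), Nat.div_eq_of_lt, zero_add]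
      have := x.isLt
      have ha : (a : ℕ) ≤ 1 := by omega
      have := Nat.mul_le_mul_left (2 ^ (l : ℕ)) ha
      rw [pow_succ]
      omega
    · rw [pow_succ, mul_assoc, add_assoc, ← mul_add, Nat.add_mul_mod_self_left,
        Nat.mod_eq_of_lt x.isLt]
  simp only [StrideAdj, key, Equiv.symm_apply_apply, Fin.ext_iff]

/-- Matrices whose supports respect the strides are the factor matrices of a block butterfly
matrix with no more nonzero parameters than they have nonzero entries. -/
theorem exists_blockButterflyMatrix_eq_prod {p b : ℕ}
    (X : Fin p → Matrix (Fin (2 ^ p) × Fin b) (Fin (2 ^ p) × Fin b) ℝ)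
    (hX : ∀ l r c, X l r c ≠ 0 → StrideAdj l r.1 c.1) :
    ∃ θ : BlockButterflyIndex p b → ℝ,
      blockButterflyMatrix θ = (List.ofFn fun i : Fin p => X i.rev).prod ∧
      Nat.card {i // θ i ≠ 0} ≤ ∑ l, matrixNnz (X l) := by
  refine ⟨fun i => X i.1 (strideEquiv i.1 (i.2.1, i.2.2.1, i.2.2.2.2.1), i.2.2.2.2.2.1)
    (strideEquiv i.1 (i.2.1, i.2.2.2.1, i.2.2.2.2.1), i.2.2.2.2.2.2), ?_, ?_⟩
  · rw [blockButterflyMatrix]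
    congr 2
    funext i
    ext r c
    have h := mt (hX i.rev r c)
    rw [strideAdj_iff, not_not] at h
    simp only [blockButterflyFactorMatrix, blockButterflyFactor, Matrix.of_apply]
    obtain ⟨r, x⟩ := r
    obtain ⟨c, y⟩ := c
    obtain ⟨⟨t, a, j⟩, rfl⟩ := (strideEquiv i.rev).surjective r
    obtain ⟨⟨t', a', j'⟩, rfl⟩ := (strideEquiv i.rev).surjective c
    simp only [Equiv.symm_apply_apply] at h ⊢
    by_cases h1 : t = t'
    · subst h1
      by_cases h2 : j = j'
      · subst h2
        simp
      · simp only [h2, and_false, not_false_eq_true, forall_const] at h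
        simp [h2, h]
    · simp [h1, h]
  · have : ∑ l, matrixNnz (X l) =
        Nat.card (Σ l, {e : (Fin (2 ^ p) × Fin b) × (Fin (2 ^ p) × Fin b) // X l e.1 e.2 ≠ 0}) := by
      rw [Nat.card_sigma]
      rfl
    rw [this]
    refine Nat.card_le_card_of_injective (fun i => ⟨i.1.1, ⟨(_, _), i.2⟩⟩) ?_
    rintro ⟨⟨l, t, a, c, j, x, y⟩, h⟩ ⟨⟨l', t', a', c', j', x', y'⟩, h'⟩ e
    simp only [Sigma.mk.injEq] at e
    obtain ⟨rfl, e⟩ := e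
    simp only [heq_eq_eq, Subtype.mk.injEq, Prod.mk.injEq, EmbeddingLike.apply_eq_iff_eq] at e
    obtain ⟨⟨⟨rfl, rfl, rfl⟩, rfl⟩, ⟨-, rfl, -⟩, rfl⟩ := e
    rfl

open Classical in
/-- The matrix with a one in column `u k` and row `v k` for every `k`, and zeros elsewhere. -/
noncomputable def routeMatrix {α ι : Type*} (u v : α → ι) : Matrix ι ι ℝ :=
  Matrix.of fun r c => if ∃ k, u k = c ∧ v k = r then 1 else 0

theorem routeMatrix_transpose {α ι : Type*} (u v : α → ι) :
    (routeMatrix u v).transpose = routeMatrix v u := by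
  ext r c
  simp only [routeMatrix, Matrix.transpose_apply, Matrix.of_apply]
  congr 1
  simp only [and_comm]

/-- The first hypothesis makes the middle index unique, so that no entry of the product exceeds one;
the second excludes mixed paths that enter the middle along one `k` and leave it along another. -/
theorem routeMatrix_mul {α ι : Type*} [Fintype ι] (u v w : α → ι)
    (huv : ∀ k k', u k = u k' → v k = v k') (hvw : ∀ k k', v k = v k' → w k = w k') :
    routeMatrix v w * routeMatrix u v = routeMatrix u w := by
  classical
  ext r c
  simp only [routeMatrix, Matrix.mul_apply, Matrix.of_apply, ite_zero_mul_ite_zero, mul_one]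
  by_cases h : ∃ k, u k = c ∧ w k = r
  · rw [if_pos h]
    obtain ⟨k, rfl, rfl⟩ := h
    rw [Finset.sum_eq_single (v k)]
    · exact if_pos ⟨⟨k, rfl, rfl⟩, ⟨k, rfl, rfl⟩⟩
    · rintro m - hm
      refine if_neg ?_
      rintro ⟨-, k', h1, rfl⟩
      exact hm (huv _ _ h1)
    · simp
  · rw [if_neg h]
    refine Finset.sum_eq_zero fun m _ => if_neg ?_
    rintro ⟨⟨k', hk', rfl⟩, k, rfl, hk⟩
    exact h ⟨k, rfl, hvw _ _ (hk.trans hk'.symm)⟩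

theorem matrixNnz_routeMatrix_le {α ι : Type*} [Finite α] [Fintype ι] (u v : α → ι) :
    matrixNnz (routeMatrix u v) ≤ Nat.card α := by
  refine matrixNnz_le_of_support _ (fun k => (v k, u k)) fun r c h => ?_
  simp only [routeMatrix, Matrix.of_apply, ne_eq, ite_eq_right_iff, one_ne_zero, imp_false,
    not_not] at h
  obtain ⟨k, rfl, rfl⟩ := h
  exact ⟨k, rfl⟩

/-- In a butterfly network whose switches act on the lowest binary digit first, the paths from
`u k` to `v k` only meet when they have the same end. -/
def Routable {α β : Type*} (u v : α → ℕ × β) : Prop :=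
  (∀ k k', u k = u k' → v k = v k') ∧
  ∀ l k k', (u k).1 / 2 ^ l = (u k').1 / 2 ^ l → (v k).1 % 2 ^ l = (v k').1 % 2 ^ l →
    (v k).2 = (v k').2 → v k = v k'

theorem Routable.comp {α β γ : Type*} {u v : α → ℕ × β} (h : Routable u v) (f : γ → α) :
    Routable (u ∘ f) (v ∘ f) :=
  ⟨fun _ _ => h.1 _ _, fun l _ _ => h.2 l _ _⟩

/-- The coordinates of an index of the block matrix, with the block number as a natural number. -/
def blockCoord {p b : ℕ} (i : Fin (2 ^ p) × Fin b) : ℕ × Fin b := (i.1, i.2)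

theorem blockCoord_injective {p b : ℕ} :
    Function.Injective (blockCoord : Fin (2 ^ p) × Fin b → ℕ × Fin b) := by
  rintro ⟨i, x⟩ ⟨j, y⟩ h
  simpa [blockCoord, Fin.ext_iff] using h

theorem mix_lt {p l i j : ℕ} (hl : l ≤ p) (hi : i < 2 ^ p) :
    i / 2 ^ l * 2 ^ l + j % 2 ^ l < 2 ^ p := by
  have h1 : i / 2 ^ l < 2 ^ (p - l) := by
    rw [Nat.div_lt_iff_lt_mul (by positivity), ← pow_add]
    rwa [Nat.sub_add_cancel hl]
  have h2 : j % 2 ^ l < 2 ^ l := Nat.mod_lt _ (by positivity)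
  have h3 : (i / 2 ^ l + 1) * 2 ^ l ≤ 2 ^ (p - l) * 2 ^ l := Nat.mul_le_mul_right _ h1
  rw [← pow_add, Nat.sub_add_cancel hl] at h3
  linarith

theorem mix_div (l i j : ℕ) : (i / 2 ^ l * 2 ^ l + j % 2 ^ l) / 2 ^ l = i / 2 ^ l := by
  rw [add_comm, Nat.add_mul_div_right _ _ (by positivity),
    Nat.div_eq_of_lt (Nat.mod_lt _ (by positivity)), zero_add]

theorem mix_mod (l i j : ℕ) : (i / 2 ^ l * 2 ^ l + j % 2 ^ l) % 2 ^ l = j % 2 ^ l := by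
  rw [add_comm, Nat.add_mul_mod_self_right, Nat.mod_mod]

/-- The node that the path from `u` to `v` passes after the `l` lowest levels. -/
def pathNode {p b : ℕ} (l : ℕ) (u v : Fin (2 ^ p) × Fin b) : Fin (2 ^ p) × Fin b :=
  if l = 0 then u else
    if h : l ≤ p then (⟨u.1 / 2 ^ l * 2 ^ l + v.1 % 2 ^ l, mix_lt h u.1.isLt⟩, v.2) else v

theorem pathNode_zero {p b : ℕ} (u v : Fin (2 ^ p) × Fin b) : pathNode 0 u v = u := rfl

theorem pathNode_fst {p b l : ℕ} (hl : l ≤ p) (u v : Fin (2 ^ p) × Fin b) :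
    ((pathNode l u v).1 : ℕ) = u.1 / 2 ^ l * 2 ^ l + v.1 % 2 ^ l := by
  unfold pathNode
  split_ifs with h
  · subst h; simp [Nat.mod_one]
  · rfl

theorem pathNode_snd {p b l : ℕ} (hl : l ≠ 0) (u v : Fin (2 ^ p) × Fin b) :
    (pathNode l u v).2 = v.2 := by
  unfold pathNode
  rw [if_neg hl]
  split_ifs <;> rfl

theorem pathNode_self {p b : ℕ} (hp : p ≠ 0) (u v : Fin (2 ^ p) × Fin b) :
    pathNode p u v = v := by
  refine Prod.ext (Fin.ext ?_) (pathNode_snd hp u v)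
  rw [pathNode_fst le_rfl, Nat.div_eq_of_lt u.1.isLt, Nat.mod_eq_of_lt v.1.isLt]
  simp

/-- One step changes digit `l` of the block number only. The change of position inside the block at
the first step costs nothing, since the blocks are full matrices. -/
theorem strideAdj_pathNode {p b l : ℕ} (hl : l < p) (u v : Fin (2 ^ p) × Fin b) :
    StrideAdj l (pathNode (l + 1) u v).1 (pathNode l u v).1 := by
  rw [StrideAdj, pathNode_fst hl, pathNode_fst hl.le, mix_div, mix_mod]
  constructor
  · rw [pow_succ 2 l, ← Nat.div_div_eq_div_mul, ← Nat.div_div_eq_div_mul, mix_div]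
  · conv_lhs => rw [pow_succ, ← mul_assoc]
    rw [mul_right_comm, Nat.mul_add_mod_self_right, Nat.mod_mul_right_mod]

/-- For `l > 0` a node records the high digits of `u`, the low digits of `v` and the position of `v`
in its block, which is exactly the data in the second clause of `Routable`; `l = 0` is the first
clause. -/
theorem Routable.pathNode_refines {α : Type*} {p b : ℕ} {u v : α → Fin (2 ^ p) × Fin b}
    (h : Routable (blockCoord ∘ u) (blockCoord ∘ v)) {l : ℕ} (hl : l ≤ p) (k k' : α)
    (hk : pathNode l (u k) (v k) = pathNode l (u k') (v k')) : v k = v k' := by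
  by_cases h0 : l = 0
  · subst h0
    exact blockCoord_injective (h.1 k k' (congrArg blockCoord hk))
  · have h1 := congrArg (fun z => (z.1 : ℕ)) hk
    have h2 := congrArg Prod.snd hk
    simp only [pathNode_fst hl] at h1
    rw [pathNode_snd h0, pathNode_snd h0] at h2
    refine blockCoord_injective (h.2 l k k' ?_ ?_ h2)
    · have := congrArg (· / 2 ^ l) h1
      simpa only [mix_div, Function.comp_apply, blockCoord] using this
    · have := congrArg (· % 2 ^ l) h1
      simpa only [mix_mod, Function.comp_apply, blockCoord] using this

/-- Paths that meet have the same end, hence continue together. This is what allows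
`routeMatrix_mul` to compose the steps. -/
theorem Routable.pathNode_succ {α : Type*} {p b : ℕ} {u v : α → Fin (2 ^ p) × Fin b}
    (h : Routable (blockCoord ∘ u) (blockCoord ∘ v)) {l : ℕ} (hl : l < p) (k k' : α)
    (hk : pathNode l (u k) (v k) = pathNode l (u k') (v k')) :
    pathNode (l + 1) (u k) (v k) = pathNode (l + 1) (u k') (v k') := by
  have hv := h.pathNode_refines hl.le k k' hk
  refine Prod.ext (Fin.ext ?_) ?_
  · have h1 := congrArg (fun z => (z.1 : ℕ) / 2 ^ l) hk
    simp only [pathNode_fst hl.le, mix_div] at h1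
    rw [pathNode_fst hl, pathNode_fst hl, hv, pow_succ, ← Nat.div_div_eq_div_mul, h1,
      Nat.div_div_eq_div_mul]
  · rw [pathNode_snd (by simp), pathNode_snd (by simp), hv]

/-- The steps telescope, the largest stride being the last step and so leftmost. The case `q = 0` is
excluded because the empty product is the full identity, not the identity on the range of `u`. -/
theorem routeMatrix_pathNode_prod {α : Type*} {p b : ℕ} {u v : α → Fin (2 ^ p) × Fin b}
    (h : Routable (blockCoord ∘ u) (blockCoord ∘ v)) (q : ℕ) (hq0 : q ≠ 0) (hq : q ≤ p) :
    (List.ofFn fun i : Fin q => routeMatrix (fun k => pathNode (i.rev : ℕ) (u k) (v k))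
      (fun k => pathNode ((i.rev : ℕ) + 1) (u k) (v k))).prod =
      routeMatrix u (fun k => pathNode q (u k) (v k)) := by
  induction q with
  | zero => exact absurd rfl hq0
  | succ q ih =>
    by_cases h0 : q = 0
    · subst h0
      simp [pathNode_zero]
    · rw [List.ofFn_succ, List.prod_cons]
      have e : ∀ i : Fin q, (i.succ.rev : ℕ) = i.rev := fun i => by
        simp [Fin.val_rev]
      simp only [e, Fin.rev_zero, Fin.val_last]
      rw [ih h0 (by omega), routeMatrix_mul]
      · intro k k' hk
        have : ∀ l, l ≤ q → pathNode l (u k) (v k) = pathNode l (u k') (v k') := by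
          intro l
          induction l with
          | zero => exact fun _ => hk
          | succ l ihl => exact fun hl => h.pathNode_succ (by omega) k k' (ihl (by omega))
        exact this q le_rfl
      · intro k k' hk
        exact h.pathNode_succ (by omega) k k' hk

theorem Routable.exists_blockButterflyMatrix {α : Type*} [Finite α] {p b : ℕ} (hp : p ≠ 0)
    {u v : α → Fin (2 ^ p) × Fin b} (h : Routable (blockCoord ∘ u) (blockCoord ∘ v)) :
    ∃ θ : BlockButterflyIndex p b → ℝ, blockButterflyMatrix θ = routeMatrix u v ∧
      Nat.card {i // θ i ≠ 0} ≤ p * Nat.card α := by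
  obtain ⟨θ, h1, h2⟩ := exists_blockButterflyMatrix_eq_prod
    (fun l : Fin p => routeMatrix (fun k => pathNode (l : ℕ) (u k) (v k))
      (fun k => pathNode ((l : ℕ) + 1) (u k) (v k))) (by
      intro l r c hrc
      simp only [routeMatrix, Matrix.of_apply, ne_eq, ite_eq_right_iff, one_ne_zero, imp_false,
        not_not] at hrc
      obtain ⟨k, rfl, rfl⟩ := hrc
      exact strideAdj_pathNode l.isLt _ _)
  refine ⟨θ, ?_, h2.trans ?_⟩
  · rw [h1, routeMatrix_pathNode_prod h p hp le_rfl]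
    simp only [pathNode_self hp]
  · refine (Finset.sum_le_sum fun l _ => matrixNnz_routeMatrix_le _ _).trans ?_
    simp

/-- The row (or column) number of the index with block number `z.1` and place `z.2`. -/
def blockPos {b : ℕ} (z : ℕ × Fin b) : ℤ := z.1 * b + z.2

theorem blockPos_injective {b : ℕ} : Function.Injective (blockPos : ℕ × Fin b → ℤ) := by
  rintro ⟨i, x⟩ ⟨j, y⟩ h
  have h' : x + b * i = y + b * j := by
    have : (x : ℤ) + b * i = y + b * j := by
      simp only [blockPos] at h
      linarith
    exact_mod_cast this
  have hb : 0 < b := x.pos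
  have h1 := congrArg (· / b) h'
  have h2 := congrArg (· % b) h'
  simp only [Nat.add_mul_div_left _ _ hb, Nat.div_eq_of_lt x.isLt, Nat.div_eq_of_lt y.isLt,
    zero_add, Nat.add_mul_mod_self_left, Nat.mod_eq_of_lt x.isLt, Nat.mod_eq_of_lt y.isLt] at h1 h2
  exact Prod.ext h1 (Fin.ext h2)

/-- If the block numbers of two sources agree above digit `l`, their positions differ by less than
`2 ^ l * b`. If the targets agree in the low `l` digits and inside the block, their positions differ
by a multiple of `2 ^ l * b`. A contraction therefore forces equal targets. -/
theorem routable_of_lipschitz {α : Type*} {b : ℕ} (u v : α → ℕ × Fin b)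
    (h : ∀ k k', |blockPos (v k) - blockPos (v k')| ≤ |blockPos (u k) - blockPos (u k')|) :
    Routable u v := by
  have key : ∀ k k', ∀ d : ℕ, 0 < d → (u k).1 / d = (u k').1 / d → (v k).1 % d = (v k').1 % d →
      (v k).2 = (v k').2 → (v k).1 ≤ (v k').1 := by
    intro k k' d hd h1 h2 h3
    by_contra! hlt
    have h4 := Nat.div_add_mod (v k).1 d
    have h5 := Nat.div_add_mod (v k').1 d
    have h6 := Nat.div_add_mod (u k).1 d
    have h7 := Nat.div_add_mod (u k').1 d
    have h8 := Nat.mod_lt (u k).1 hd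
    have h9 := Nat.mod_lt (u k').1 hd
    have h10 : (v k').1 / d + 1 ≤ (v k).1 / d := by
      by_contra! hc
      have := Nat.mul_le_mul_left d (Nat.lt_succ_iff.mp hc)
      omega
    have h11 : d * ((v k').1 / d) + d ≤ d * ((v k).1 / d) := by nlinarith
    have h12 : ((v k').1 + d) * b ≤ (v k).1 * b := Nat.mul_le_mul_right _ (by omega)
    have h13 : ((u k).1 + 1) * b ≤ ((u k').1 + d) * b := Nat.mul_le_mul_right _ (by
      rw [h1] at h6; omega)
    have h14 : ((u k').1 + 1) * b ≤ ((u k).1 + d) * b := Nat.mul_le_mul_right _ (by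
      rw [h1] at h6; omega)
    have h15 := (u k).2.isLt
    have h16 := (u k').2.isLt
    have h17 := (le_abs_self _).trans (h k k')
    simp only [blockPos, h3] at h17
    zify at h12 h13 h14 h15 h16
    rcases le_abs'.mp h17 with h18 | h18 <;> nlinarith
  refine ⟨fun k k' hk => blockPos_injective ?_, fun l k k' h1 h2 h3 => Prod.ext ?_ h3⟩
  · have := h k k'
    rw [hk, sub_self, abs_zero, abs_nonpos_iff] at this
    exact sub_eq_zero.mp this
  · exact (key k k' _ (by positivity) h1 h2 h3).antisymm
      (key k' k _ (by positivity) h1.symm h2.symm h3.symm)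

/-! ### Rearrangeability of the Beneš network -/

/-- Two fixed point free involutions of a set have a common proper 2-colouring. -/
theorem exists_two_coloring {α : Type*} (s t : Equiv.Perm α) (hs : ∀ x, s (s x) = x)
    (ht : ∀ x, t (t x) = x) (hs' : ∀ x, s x ≠ x) (ht' : ∀ x, t x ≠ x) :
    ∃ c : α → Bool, (∀ x, c (s x) ≠ c x) ∧ ∀ x, c (t x) ≠ c x := by
  have hs1 : s⁻¹ = s := by ext x; rw [Equiv.Perm.inv_eq_iff_eq, hs]
  have ht1 : t⁻¹ = t := by ext x; rw [Equiv.Perm.inv_eq_iff_eq, ht]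
  -- In this dihedral action `s` inverts `τ`, so it permutes the orbits of `τ`. No orbit is mapped
  -- to itself, and `t` pairs the orbits in the same way as `s`; colouring one orbit of each pair
  -- solves the problem.
  set τ : Equiv.Perm α := s * t with hτ
  have hconj : ∀ k : ℤ, s * τ ^ k = τ ^ (-k) * s := by
    intro k
    have h1 : s * τ * s⁻¹ = τ⁻¹ := by
      rw [hτ, mul_inv_rev, hs1, ht1]
      ext x
      simp [hs]
    have h2 := conj_zpow (i := k) (a := s) (b := τ)
    rw [h1, inv_zpow'] at h2
    rw [h2]
    group
  -- If `s x = τ ^ k x`, the midpoint `τ ^ j x` is a fixed point of `s` for `k = 2 * j` and of `t`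
  -- for `k = 2 * j + 1`.
  have hfree : ∀ (k : ℤ) (x : α), (τ ^ k) x ≠ s x := by
    intro k x hk
    obtain ⟨j, rfl | rfl⟩ := Int.even_or_odd' k
    · refine hs' ((τ ^ j) x) ?_
      rw [← Equiv.Perm.mul_apply, hconj, Equiv.Perm.mul_apply, ← hk, ← Equiv.Perm.mul_apply,
        ← zpow_add]
      congr 2
      ring
    · refine ht' ((τ ^ j) x) ?_
      have h1 : (t * τ ^ (2 * j)) x = x := by
        apply s.injective
        rw [← hk, add_comm, zpow_add, zpow_one, hτ]
        rfl
      have h2 : t * τ ^ j = τ ^ (-j) * t := by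
        have h3 : t = s * τ := by
          rw [hτ]; ext x; simp [hs]
        rw [h3, mul_assoc, ← zpow_one_add, hconj, ← mul_assoc, ]
        have : s * τ = τ ^ (-1 : ℤ) * s := by simpa using hconj 1
        rw [mul_assoc, this, ← mul_assoc, ← zpow_add]
        congr 2
        ring
      rw [← Equiv.Perm.mul_apply, h2, Equiv.Perm.mul_apply]
      have h4 : t x = (τ ^ (2 * j)) x := by
        apply t.injective
        rw [ht]
        exact h1.symm
      rw [h4, ← Equiv.Perm.mul_apply, ← zpow_add]
      congr 2
      ring
  let S := Equiv.Perm.SameCycle.setoid τ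
  let q : α → Quotient S := Quotient.mk S
  have hq : ∀ x y, q x = q y ↔ τ.SameCycle x y := fun x y => Quotient.eq
  have hqs : ∀ x y, q x = q y → q (s x) = q (s y) := by
    intro x y h
    rw [hq] at h ⊢
    obtain ⟨k, rfl⟩ := h
    refine ⟨-k, ?_⟩
    rw [← Equiv.Perm.mul_apply, ← Equiv.Perm.mul_apply, hconj]
  have hne : ∀ x, q (s x) ≠ q x := by
    intro x h
    obtain ⟨k, hk⟩ := (hq _ _).mp h.symm
    exact hfree k x hk
  have hqt : ∀ x, q (t x) = q (s x) := by
    intro x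
    have : q (τ x) = q x := (hq _ _).mpr ⟨-1, by simp⟩
    have h := hqs _ _ this
    rwa [hτ, Equiv.Perm.mul_apply, hs] at h
  classical
  -- An arbitrary linear order serves only to select one orbit from each pair.
  let r : LinearOrder (Quotient S) := linearOrderOfSTO WellOrderingRel
  refine ⟨fun x => decide (q x < q (s x)), fun x => ?_, fun x => ?_⟩
  · simp only [hs]
    rcases lt_or_gt_of_ne (hne x) with h | h <;> simp [h, h.le]
  · have : q (s (t x)) = q x := by rw [hqs _ _ (hqt x), hs]
    simp only [this, hqt]
    rcases lt_or_gt_of_ne (hne x) with h | h <;> simp [h, h.le]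

/-- Induction on the number of digits. Indices whose images under `u`, or under `v`, differ only in
the top digit compete for the same nodes below the last level, so they must lie in different halves.
A 2-colouring provides the top digit of `w`, and each colour class is a problem with one digit less.
-/
theorem exists_routable_pair {β : Type*} (p : ℕ) : ∀ {α : Type*} (u v : α → ℕ × β),
    Function.Injective u → Set.range u = {z | z.1 < 2 ^ p} →
    Function.Injective v → Set.range v = {z | z.1 < 2 ^ p} →
    ∃ w : α → ℕ × β, (∀ k, (w k).1 < 2 ^ p) ∧ Routable w u ∧ Routable w v := by
  induction p with
  | zero =>
    intro α u v hu hu' hv hv'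
    have hu0 : ∀ k, (u k).1 = 0 := fun k => by
      simpa using hu'.le ⟨k, rfl⟩
    have hv0 : ∀ k, (v k).1 = 0 := fun k => by
      simpa using hv'.le ⟨k, rfl⟩
    refine ⟨u, fun k => by simp [hu0], ⟨fun _ _ => id, fun l k k' _ _ h => ?_⟩,
      ⟨fun k k' h => ?_, fun l k k' _ _ h => ?_⟩⟩
    · exact Prod.ext (by rw [hu0, hu0]) h
    · rw [hu h]
    · exact Prod.ext (by rw [hv0, hv0]) h
  | succ p ih =>
    intro α u v hu hu' hv hv'
    -- The partner of an index is the one whose image under `f` has the opposite top digit.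
    have invol : ∀ f : α → ℕ × β, Function.Injective f → Set.range f = {z | z.1 < 2 ^ (p + 1)} →
        ∃ s : Equiv.Perm α, (∀ x, s (s x) = x) ∧ (∀ x, s x ≠ x) ∧
          (∀ x, (f (s x)).1 % 2 ^ p = (f x).1 % 2 ^ p ∧ (f (s x)).2 = (f x).2) ∧
          ∀ x y, (f x).1 % 2 ^ p = (f y).1 % 2 ^ p → (f x).2 = (f y).2 → y = x ∨ y = s x := by
      intro f hf hf'
      have hlt : ∀ k, (f k).1 < 2 ^ (p + 1) := fun k => hf'.le ⟨k, rfl⟩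
      have hex : ∀ k, ∃ k', f k' = (if (f k).1 < 2 ^ p then (f k).1 + 2 ^ p else (f k).1 - 2 ^ p,
          (f k).2) := by
        intro k
        apply hf'.ge
        have := hlt k
        rw [pow_succ] at this
        simp only [Set.mem_ofPred_eq]
        rw [pow_succ]
        split_ifs <;> omega
      choose s hs using hex
      have hss : ∀ x, s (s x) = x := by
        intro x
        apply hf
        have := hlt x
        rw [pow_succ] at this
        rw [hs, hs]
        refine Prod.ext ?_ rfl
        simp only
        split_ifs <;> omega
      refine ⟨⟨s, s, hss, hss⟩, hss, fun x h => ?_, fun x => ?_, fun x y h1 h2 => ?_⟩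
      · have h1 := congrArg Prod.fst (hs x)
        simp only [Equiv.coe_fn_mk] at h
        rw [h] at h1
        simp only at h1
        have : 0 < 2 ^ p := by positivity
        split_ifs at h1 <;> omega
      · simp only [Equiv.coe_fn_mk, hs, and_true]
        split_ifs with h
        · simp
        · exact (Nat.mod_eq_sub_mod (not_lt.mp h)).symm
      · simp only [Equiv.coe_fn_mk]
        have hx := hlt x
        have hy := hlt y
        rw [pow_succ] at hx hy
        have e : ∀ z, z < 2 ^ p * 2 → z % 2 ^ p = if z < 2 ^ p then z else z - 2 ^ p := by
          intro z hz
          split_ifs with h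
          · exact Nat.mod_eq_of_lt h
          · rw [Nat.mod_eq_sub_mod (not_lt.mp h), Nat.mod_eq_of_lt (by omega)]
        rw [e _ hx, e _ hy] at h1
        by_cases hxy : (f x).1 = (f y).1
        · exact Or.inl (hf (Prod.ext hxy.symm h2.symm))
        · refine Or.inr (hf ?_)
          rw [hs]
          refine Prod.ext ?_ h2.symm
          simp only
          split_ifs at h1 ⊢ <;> omega
    obtain ⟨s, hs, hs', hsf, hsu⟩ := invol u hu hu'
    obtain ⟨t, ht, ht', htf, htu⟩ := invol v hv hv'
    obtain ⟨c, hcs, hct⟩ := exists_two_coloring s t hs ht hs' ht'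
    -- A colour class contains exactly one index of each pair, so dropping the top digit is a
    -- bijection on it.
    have low : ∀ (f : α → ℕ × β) (σ : Equiv.Perm α), Set.range f = {z | z.1 < 2 ^ (p + 1)} →
        (∀ x, (f (σ x)).1 % 2 ^ p = (f x).1 % 2 ^ p ∧ (f (σ x)).2 = (f x).2) →
        (∀ x y, (f x).1 % 2 ^ p = (f y).1 % 2 ^ p → (f x).2 = (f y).2 → y = x ∨ y = σ x) →
        (∀ x, c (σ x) ≠ c x) → ∀ e : Bool,
        Function.Injective (fun k : {k // c k = e} => ((f k).1 % 2 ^ p, (f k).2)) ∧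
        Set.range (fun k : {k // c k = e} => ((f k).1 % 2 ^ p, (f k).2)) = {z | z.1 < 2 ^ p} := by
      intro f σ hf' hσ hfσ hc e
      constructor
      · rintro ⟨x, hx⟩ ⟨y, hy⟩ h
        simp only [Prod.mk.injEq] at h
        rcases hfσ x y h.1 h.2 with h1 | h1
        · exact Subtype.ext h1.symm
        · exact absurd (by rw [← h1, hx, hy]) (hc x)
      · ext ⟨i, z⟩
        constructor
        · rintro ⟨k, hk⟩
          rw [← hk]
          exact Nat.mod_lt _ (by positivity)
        · intro hi
          simp only [Set.mem_ofPred_eq] at hi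
          obtain ⟨k, hk⟩ : (i, z) ∈ Set.range f := hf'.ge (hi.trans (by
            rw [pow_succ]; have : 0 < 2 ^ p := by positivity
            omega))
          by_cases hce : c k = e
          · exact ⟨⟨k, hce⟩, by simp [hk, Nat.mod_eq_of_lt hi]⟩
          · refine ⟨⟨σ k, ?_⟩, ?_⟩
            · have := hc k
              revert this hce
              cases c k <;> cases c (σ k) <;> cases e <;> simp
            · simp [hσ, hk, Nat.mod_eq_of_lt hi]
    have hlu := low u s hu' hsf hsu hcs
    have hlv := low v t hv' htf htu hct
    have ih' := fun e : Bool => ih _ _ (hlu e).1 (hlu e).2 (hlv e).1 (hlv e).2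
    choose w hw hwu hwv using ih'
    have step : ∀ f : α → ℕ × β,
        (∀ e, Function.Injective (fun k : {k // c k = e} => ((f k).1 % 2 ^ p, (f k).2))) →
        (∀ k, (f k).1 < 2 ^ (p + 1)) →
        (∀ e, Routable (w e) (fun k : {k // c k = e} => ((f k).1 % 2 ^ p, (f k).2))) →
        Routable (fun k => ((c k).toNat * 2 ^ p + (w (c k) ⟨k, rfl⟩).1, (w (c k) ⟨k, rfl⟩).2))
          f := by
      intro f hf hlt hwf
      have top : ∀ k, ((c k).toNat * 2 ^ p + (w (c k) ⟨k, rfl⟩).1) / 2 ^ p = (c k).toNat := by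
        intro k
        rw [add_comm, Nat.add_mul_div_right _ _ (by positivity), Nat.div_eq_of_lt (hw _ _),
          zero_add]
      -- Both indices are moved to one common colour `e`, since `w` is a dependent family over the
      -- colours.
      have tolow : ∀ k k', c k = c k' → ∃ e, ∃ (hk : c k = e) (hk' : c k' = e),
          w (c k) ⟨k, rfl⟩ = w e ⟨k, hk⟩ ∧ w (c k') ⟨k', rfl⟩ = w e ⟨k', hk'⟩ := by
        intro k k' h
        have hw' : ∀ e (hk : c k = e), w (c k) ⟨k, rfl⟩ = w e ⟨k, hk⟩ := by
          rintro e rfl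
          rfl
        exact ⟨c k', h, rfl, hw' _ _, rfl⟩
      constructor
      · intro k k' h
        simp only [Prod.mk.injEq] at h
        have hc : c k = c k' := by
          have := congrArg (· / 2 ^ p) h.1
          simp only [top] at this
          exact by revert this; cases c k <;> cases c k' <;> simp
        obtain ⟨e, hk, hk', h1, h2⟩ := tolow k k' hc
        rw [h1, h2, hc] at h
        have h3 := (hwf e).1 ⟨k, hk⟩ ⟨k', hk'⟩ (Prod.ext (Nat.add_left_cancel h.1) h.2)
        have h4 := hf e h3
        simp only [Subtype.mk.injEq] at h4
        rw [h4]
      · intro l k k' h1 h2 h3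
        simp only at h1
        -- Beyond level `p` all digits of the target are already in place. Up to level `p` the top
        -- digit of `w` is still visible, so the two colours cannot collide and the inductive
        -- hypothesis applies.
        rcases Nat.lt_or_ge p l with hl | hl
        · have h4 : ∀ k, (f k).1 % 2 ^ l = (f k).1 := fun k =>
            Nat.mod_eq_of_lt ((hlt k).trans_le (Nat.pow_le_pow_right (by norm_num) hl))
          rw [h4, h4] at h2
          exact Prod.ext h2 h3
        · obtain ⟨d, rfl⟩ := Nat.exists_eq_add_of_le hl
          have hc : c k = c k' := by
            have := congrArg (· / 2 ^ d) h1
            simp only [Nat.div_div_eq_div_mul, ← pow_add, top] at this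
            exact by revert this; cases c k <;> cases c k' <;> simp
          obtain ⟨e, hk, hk', h4, h5⟩ := tolow k k' hc
          rw [h4, h5, hc] at h1
          have h6 : ∀ a b : ℕ, (a * 2 ^ (l + d) + b) / 2 ^ l = a * 2 ^ d + b / 2 ^ l := by
            intro a b
            rw [pow_add, mul_comm (2 ^ l), ← mul_assoc, add_comm,
              Nat.add_mul_div_right _ _ (by positivity), add_comm]
          rw [h6, h6] at h1
          have h7 := (hwf e).2 l ⟨k, hk⟩ ⟨k', hk'⟩ (Nat.add_left_cancel h1) (by
            simp only [pow_add, Nat.mod_mul_right_mod]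
            exact h2) h3
          have h8 := hf e h7
          simp only [Subtype.mk.injEq] at h8
          rw [h8]
    refine ⟨fun k => ((c k).toNat * 2 ^ p + (w (c k) ⟨k, rfl⟩).1, (w (c k) ⟨k, rfl⟩).2), ?_,
      step u (fun e => (hlu e).1) (fun k => hu'.le ⟨k, rfl⟩) hwu,
      step v (fun e => (hlv e).1) (fun k => hv'.le ⟨k, rfl⟩) hwv⟩
    intro k
    have h1 := hw (c k) ⟨k, rfl⟩
    have h2 : (c k).toNat * 2 ^ p ≤ 1 * 2 ^ p := Nat.mul_le_mul_right _ (Bool.toNat_le _)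
    simp only
    rw [pow_succ]
    omega

/-! ### Sparse matrices as products of block butterfly matrices -/

/-- `M` is a product of `c` block butterfly matrices and transposes with at most `N` nonzero
parameters. -/
def HasButterflyProduct {p b : ℕ} (c N : ℕ)
    (M : Matrix (Fin (2 ^ p) × Fin b) (Fin (2 ^ p) × Fin b) ℝ) : Prop :=
  ∃ L : List (Bool × (BlockButterflyIndex p b → ℝ)),
    L.length = c ∧ blockButterflyProduct L = M ∧ numNonzeroParams L ≤ N

theorem HasButterflyProduct.mul {p b c c' N N' : ℕ}
    {M M' : Matrix (Fin (2 ^ p) × Fin b) (Fin (2 ^ p) × Fin b) ℝ}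
    (h : HasButterflyProduct c N M) (h' : HasButterflyProduct c' N' M') :
    HasButterflyProduct (c + c') (N + N') (M * M') := by
  obtain ⟨L, h1, h2, h3⟩ := h
  obtain ⟨L', h1', h2', h3'⟩ := h'
  refine ⟨L ++ L', by simp [h1, h1'], ?_, ?_⟩
  · rw [← h2, ← h2']
    simp [blockButterflyProduct]
  · simp only [numNonzeroParams, List.map_append, List.sum_append]
    exact add_le_add h3 h3'

theorem hasButterflyProduct_one {p b N : ℕ} (θ : BlockButterflyIndex p b → ℝ)
    (h : Nat.card {i // θ i ≠ 0} ≤ N) : HasButterflyProduct 1 N (blockButterflyMatrix θ) :=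
  ⟨[(false, θ)], rfl, by simp [blockButterflyProduct], by simpa [numNonzeroParams] using h⟩

theorem HasButterflyProduct.transpose {p b c N : ℕ}
    {M : Matrix (Fin (2 ^ p) × Fin b) (Fin (2 ^ p) × Fin b) ℝ}
    (h : HasButterflyProduct c N M) : HasButterflyProduct c N M.transpose := by
  obtain ⟨L, h1, rfl, h3⟩ := h
  refine ⟨(L.map fun e => (!e.1, e.2)).reverse, by simp [h1], ?_, ?_⟩
  · rw [blockButterflyProduct, blockButterflyProduct, Matrix.transpose_list_prod,
      List.map_reverse, List.map_map, List.map_map]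
    congr 2
    refine List.map_congr_left fun e _ => ?_
    obtain ⟨c, θ⟩ := e
    cases c <;> simp
  · simpa [numNonzeroParams, Function.comp_def] using h3

theorem Routable.hasButterflyProduct {α : Type*} [Finite α] {p b : ℕ} (hp : p ≠ 0)
    {u v : α → Fin (2 ^ p) × Fin b} (h : Routable (blockCoord ∘ u) (blockCoord ∘ v)) :
    HasButterflyProduct 1 (p * Nat.card α) (routeMatrix u v) := by
  obtain ⟨θ, h1, h2⟩ := h.exists_blockButterflyMatrix hp
  rw [← h1]
  exact hasButterflyProduct_one θ h2

theorem range_blockCoord (p b : ℕ) :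
    Set.range (blockCoord : Fin (2 ^ p) × Fin b → ℕ × Fin b) = {z | z.1 < 2 ^ p} := by
  ext ⟨i, x⟩
  constructor
  · rintro ⟨k, hk⟩
    rw [← hk]
    exact k.1.isLt
  · exact fun h => ⟨(⟨i, h⟩, x), rfl⟩

/-- Partial permutations are products of a block butterfly matrix and a transpose of one. -/
theorem hasButterflyProduct_of_injective {α : Type*} [Finite α] {p b : ℕ} (hp : p ≠ 0)
    {e e' : α → Fin (2 ^ p) × Fin b} (he : Function.Injective e) (he' : Function.Injective e') :
    HasButterflyProduct 2 (2 * (p * Nat.card α)) (routeMatrix e e') := by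
  obtain ⟨π, hπ⟩ := Equiv.Perm.exists_extending_pair e e' he he'
  obtain ⟨w, hw, hu, hv⟩ := exists_routable_pair p
    (blockCoord : Fin (2 ^ p) × Fin b → ℕ × Fin b) (blockCoord ∘ π)
    blockCoord_injective (range_blockCoord p b) (blockCoord_injective.comp π.injective)
    (by rw [Set.range_comp, π.range_eq_univ, Set.image_univ, range_blockCoord])
  let m : α → Fin (2 ^ p) × Fin b := fun k => (⟨(w (e k)).1, hw _⟩, (w (e k)).2)
  have hm : blockCoord ∘ m = w ∘ e := rfl
  have h1 : Routable (blockCoord ∘ m) (blockCoord ∘ e) := hm ▸ hu.comp e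
  have h2 : Routable (blockCoord ∘ m) (blockCoord ∘ e') := by
    have : blockCoord ∘ e' = (blockCoord ∘ π) ∘ e := by
      funext k
      simp [hπ]
    rw [hm, this]
    exact hv.comp e
  rw [← routeMatrix_mul e m e' (fun k k' h => congrArg m (he h))
    (fun k k' h => blockCoord_injective (h2.1 k k' (congrArg blockCoord h))),
    ← routeMatrix_transpose m e, two_mul]
  exact (h2.hasButterflyProduct hp).mul (h1.hasButterflyProduct hp).transpose

/-- The ranks of the values of a finite sequence, compared with their differences and with the
positions in the sorted sequence. -/
theorem exists_rank {s : ℕ} (F : Fin s → ℕ) :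
    ∃ (σ : Equiv.Perm (Fin s)) (g : Fin s → ℕ), (∀ k, g k < s) ∧
      (∀ k k', F k = F k' → g k = g k') ∧
      ∀ k k', F k < F k' → g k < g k' ∧ g k' + F k ≤ g k + F k' ∧ g k' + σ k ≤ g k + σ k' := by
  classical
  have hmono := Tuple.monotone_sort F
  set σ := (Tuple.sort F).symm with hσ
  have hlt : ∀ k k', F k < F k' → σ k < σ k' := by
    intro k k' h
    by_contra! hc
    have := hmono hc
    simp only [Function.comp_apply, hσ, Equiv.apply_symm_apply] at this
    omega
  let I := Finset.univ.image F
  have hI : ∀ k, F k ∈ I := fun k => Finset.mem_image_of_mem _ (Finset.mem_univ k)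
  refine ⟨σ, fun k => (I.filter (· < F k)).card, fun k => ?_, fun k k' h => by simp only [h],
    fun k k' h => ⟨?_, ?_, ?_⟩⟩
  · calc (I.filter (· < F k)).card < I.card := by
          refine Finset.card_lt_card ((Finset.filter_ssubset).mpr ⟨F k, hI k, lt_irrefl _⟩)
      _ ≤ s := Finset.card_image_le.trans (by simp)
  · refine Finset.card_lt_card ?_
    rw [Finset.ssubset_iff_of_subset]
    · exact ⟨F k, by simp [hI, h], by simp⟩
    · intro v hv
      rw [Finset.mem_filter] at hv ⊢
      exact ⟨hv.1, hv.2.trans h⟩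
  · have hsub : I.filter (· < F k') ⊆ I.filter (· < F k) ∪ Finset.Ico (F k) (F k') := by
      intro v hv
      simp only [Finset.mem_union, Finset.mem_filter, Finset.mem_Ico] at hv ⊢
      by_cases hvk : v < F k
      · exact Or.inl ⟨hv.1, hvk⟩
      · exact Or.inr ⟨not_lt.mp hvk, hv.2⟩
    have := (Finset.card_le_card hsub).trans (Finset.card_union_le _ _)
    rw [Nat.card_Ico] at this
    simp only
    omega
  · have hsub : I.filter (· < F k') ⊆
        I.filter (· < F k) ∪ (Finset.Ico (σ k) (σ k')).image (F ∘ σ.symm) := by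
      intro v hv
      simp only [Finset.mem_union, Finset.mem_filter] at hv ⊢
      by_cases hvk : v < F k
      · exact Or.inl ⟨hv.1, hvk⟩
      · refine Or.inr (Finset.mem_image.mpr ?_)
        rcases (not_lt.mp hvk).eq_or_lt with h1 | h1
        -- The value `F k` must be represented by `σ k` itself: other occurrences of it may precede
        -- that position.
        · exact ⟨σ k, by simp [hlt k k' h], by simp [h1]⟩
        · obtain ⟨m, -, rfl⟩ := Finset.mem_image.mp hv.1
          exact ⟨σ m, by simp [hlt m k' hv.2, (hlt k m h1).le], by simp⟩
    have := (Finset.card_le_card hsub).trans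
      ((Finset.card_union_le _ _).trans (Nat.add_le_add_left Finset.card_image_le _))
    rw [Fin.card_Ico] at this
    have := hlt k k' h
    simp only
    omega

/-- The index at a given position. -/
def indexAt {p b : ℕ} (i : Fin (2 ^ p * b)) : Fin (2 ^ p) × Fin b := finProdFinEquiv.symm i

theorem indexAt_injective {p b : ℕ} :
    Function.Injective (indexAt : Fin (2 ^ p * b) → Fin (2 ^ p) × Fin b) :=
  finProdFinEquiv.symm.injective

theorem blockPos_finProdFinEquiv {p b : ℕ} (z : Fin (2 ^ p) × Fin b) :
    blockPos (blockCoord z) = ((finProdFinEquiv z : ℕ) : ℤ) := by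
  simp [blockPos, blockCoord, finProdFinEquiv]
  ring

theorem blockPos_indexAt {p b : ℕ} (i : Fin (2 ^ p * b)) :
    blockPos (blockCoord (indexAt i)) = ((i : ℕ) : ℤ) := by
  rw [blockPos_finProdFinEquiv, indexAt, Equiv.apply_symm_apply]

/-- Any map from few points, as a matrix. -/
theorem hasButterflyProduct_routeMatrix {p b s : ℕ} (hp : p ≠ 0) (hs : s ≤ 2 ^ p * b)
    {e : Fin s → Fin (2 ^ p) × Fin b} (he : Function.Injective e)
    (f : Fin s → Fin (2 ^ p) × Fin b) :
    HasButterflyProduct 4 (4 * (p * s)) (routeMatrix e f) := by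
  obtain ⟨σ, g, hg, hg1, hg2⟩ := exists_rank fun k => (finProdFinEquiv (f k) : ℕ)
  -- The route is `e → e' → g' → f`: sort by target, contract the sorted positions to ranks, spread
  -- the ranks to the targets. The last step is the transpose of the contraction `f → g'`.
  let e' : Fin s → Fin (2 ^ p) × Fin b := fun k => indexAt (Fin.castLE hs (σ k))
  let g' : Fin s → Fin (2 ^ p) × Fin b := fun k => indexAt ⟨g k, (hg k).trans_le hs⟩
  have he' : Function.Injective e' := fun k k' h =>
    σ.injective (Fin.castLE_injective hs (indexAt_injective h))
  have hpe : ∀ k, blockPos (blockCoord (e' k)) = ((σ k : ℕ) : ℤ) := fun k => blockPos_indexAt _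
  have hpg : ∀ k, blockPos (blockCoord (g' k)) = (g k : ℤ) := fun k => blockPos_indexAt _
  have hpf : ∀ k, blockPos (blockCoord (f k)) = ((finProdFinEquiv (f k) : ℕ) : ℤ) := fun k =>
    blockPos_finProdFinEquiv _
  have hgf : ∀ k k', g' k = g' k' → f k = f k' := by
    intro k k' h
    have h' : g k = g k' := by
      have := hpg k
      rw [h, hpg] at this
      exact_mod_cast this.symm
    rcases lt_trichotomy (finProdFinEquiv (f k) : ℕ) (finProdFinEquiv (f k')) with h1 | h1 | h1
    · exact absurd h' (hg2 _ _ h1).1.ne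
    · exact finProdFinEquiv.injective (Fin.ext h1)
    · exact absurd h' (hg2 _ _ h1).1.ne'
  have hr1 : Routable (blockCoord ∘ e') (blockCoord ∘ g') := by
    refine routable_of_lipschitz _ _ fun k k' => ?_
    simp only [Function.comp_apply, hpe, hpg]
    rcases lt_trichotomy (finProdFinEquiv (f k) : ℕ) (finProdFinEquiv (f k')) with h1 | h1 | h1
    · obtain ⟨h2, -, h3⟩ := hg2 _ _ h1
      rw [abs_of_neg (by omega)]
      exact le_trans (by omega) (neg_le_abs _)
    · simp [hg1 _ _ h1]
    · obtain ⟨h2, -, h3⟩ := hg2 _ _ h1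
      rw [abs_of_pos (by omega)]
      exact le_trans (by omega) (le_abs_self _)
  have hr2 : Routable (blockCoord ∘ f) (blockCoord ∘ g') := by
    refine routable_of_lipschitz _ _ fun k k' => ?_
    simp only [Function.comp_apply, hpf, hpg]
    rcases lt_trichotomy (finProdFinEquiv (f k) : ℕ) (finProdFinEquiv (f k')) with h1 | h1 | h1
    · obtain ⟨h2, h3, -⟩ := hg2 _ _ h1
      rw [abs_of_neg (by omega)]
      exact le_trans (by omega) (neg_le_abs _)
    · simp [hg1 _ _ h1]
    · obtain ⟨h2, h3, -⟩ := hg2 _ _ h1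
      rw [abs_of_pos (by omega)]
      exact le_trans (by omega) (le_abs_self _)
  have h1 := (hr2.hasButterflyProduct hp).transpose
  have h2 := hr1.hasButterflyProduct hp
  have h3 := hasButterflyProduct_of_injective hp he he'
  rw [routeMatrix_transpose] at h1
  have h4 := (h1.mul h2).mul h3
  rw [routeMatrix_mul _ _ _
      (fun k k' h => blockCoord_injective (hr1.1 k k' (congrArg blockCoord h))) hgf,
    routeMatrix_mul _ _ _ (fun k k' h => congrArg e' (he h)) (fun k k' h => congrArg f (he' h)),
    Nat.card_fin] at h4
  have e4 : p * s + p * s + 2 * (p * s) = 4 * (p * s) := by ring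
  rwa [e4] at h4

theorem hasButterflyProduct_diagonal {p b : ℕ} (hp : p ≠ 0) (d : Fin (2 ^ p) × Fin b → ℝ) :
    HasButterflyProduct 1 (p * Nat.card {i // d i ≠ 0}) (Matrix.diagonal d) := by
  classical
  -- The values are placed in the factor of smallest stride. The others carry the indicator of the
  -- support instead of the identity, which keeps the number of nonzero parameters proportional to
  -- the support.
  let a : Fin p → Fin (2 ^ p) × Fin b → ℝ := fun l x =>
    if (l : ℕ) = 0 then d x else if d x = 0 then 0 else 1
  obtain ⟨θ, h1, h2⟩ := exists_blockButterflyMatrix_eq_prod (fun l => Matrix.diagonal (a l)) (by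
    intro l r c h
    rw [Matrix.diagonal_apply] at h
    split_ifs at h with hrc
    · rw [hrc]; exact ⟨rfl, rfl⟩
    · exact absurd rfl h)
  have h3 : blockButterflyMatrix θ = Matrix.diagonal d := by
    have e : (List.ofFn fun i : Fin p => Matrix.diagonal (a i.rev)) =
        (List.ofFn fun i : Fin p => a i.rev).map (Matrix.diagonalRingHom _ ℝ) := by
      rw [List.map_ofFn]
      rfl
    rw [h1, e, ← map_list_prod, Matrix.diagonalRingHom_apply, List.prod_ofFn]
    congr 1
    funext x
    rw [Finset.prod_apply, ← Equiv.prod_comp Fin.revPerm]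
    simp only [Fin.revPerm_apply, Fin.rev_rev]
    obtain ⟨q, rfl⟩ := Nat.exists_eq_succ_of_ne_zero hp
    rw [Fin.prod_univ_succ]
    by_cases hx : d x = 0 <;> simp [a, hx]
  rw [← h3]
  refine hasButterflyProduct_one θ (h2.trans ?_)
  refine (Finset.sum_le_sum (g := fun _ => Nat.card {i // d i ≠ 0}) fun l _ => ?_).trans (by simp)
  refine matrixNnz_le_of_support _ (fun k => (k.1, k.1)) fun r c h => ?_
  rw [Matrix.diagonal_apply] at h
  split_ifs at h with hrc
  · subst hrc
    refine ⟨⟨r, fun h0 => h ?_⟩, rfl⟩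
    simp [a, h0]
  · exact absurd rfl h

/-- A matrix with at most as many nonzero entries as rows is a product of nine factors. -/
theorem hasButterflyProduct_of_matrixNnz_le {p b : ℕ} (hp : p ≠ 0)
    (M : Matrix (Fin (2 ^ p) × Fin b) (Fin (2 ^ p) × Fin b) ℝ) (hM : matrixNnz M ≤ 2 ^ p * b) :
    HasButterflyProduct 9 (9 * (p * matrixNnz M)) M := by
  classical
  set s := matrixNnz M with hs
  let E : {e : (Fin (2 ^ p) × Fin b) × (Fin (2 ^ p) × Fin b) // M e.1 e.2 ≠ 0} ≃ Fin s :=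
    Finite.equivFinOfCardEq hs.symm
  let r : Fin s → Fin (2 ^ p) × Fin b := fun k => (E.symm k).1.1
  let c : Fin s → Fin (2 ^ p) × Fin b := fun k => (E.symm k).1.2
  let e : Fin s → Fin (2 ^ p) × Fin b := fun k => indexAt (Fin.castLE hM k)
  have he : Function.Injective e := fun k k' h =>
    Fin.castLE_injective hM (indexAt_injective h)
  let d : Fin (2 ^ p) × Fin b → ℝ := Function.extend e (fun k => M (r k) (c k)) 0
  have hd : Nat.card {i // d i ≠ 0} ≤ s := by
    have : ∀ i : {i // d i ≠ 0}, ∃ k, e k = i.1 := fun i => by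
      by_contra hc
      exact i.2 (Function.extend_apply' _ _ _ hc)
    choose k hk using this
    have := Nat.card_le_card_of_injective k fun i i' h => Subtype.ext (by rw [← hk, ← hk, h])
    simpa using this
  -- Entry number `k` is collected from column `c k` at `e k`, scaled there, and sent to row `r k`.
  -- Repeated rows or columns do no harm because `e` is injective.
  have hprod : routeMatrix e r * Matrix.diagonal d * (routeMatrix e c).transpose = M := by
    ext x y
    rw [routeMatrix_transpose, Matrix.mul_apply]
    simp only [Matrix.mul_diagonal, routeMatrix, Matrix.of_apply]
    by_cases hxy : M x y = 0
    · rw [hxy]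
      refine Finset.sum_eq_zero fun m _ => ?_
      split_ifs with h1 h2
      · obtain ⟨k, rfl, rfl⟩ := h1
        obtain ⟨k', rfl, hk'⟩ := h2
        rw [he hk'] at *
        exact absurd hxy (E.symm k).2
      all_goals simp
    · obtain ⟨k, hk⟩ : ∃ k, E.symm k = ⟨(x, y), hxy⟩ := E.symm.surjective _
      have hr : r k = x := by simp [r, hk]
      have hc : c k = y := by simp [c, hk]
      rw [Finset.sum_eq_single (e k)]
      · rw [if_pos ⟨k, rfl, hr⟩, if_pos ⟨k, hc, rfl⟩]
        simp only [d, he.extend_apply, hr, hc]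
        simp
      · intro m _ hm
        split_ifs with h1 h2
        · obtain ⟨k1, rfl, hk1⟩ := h1
          obtain ⟨k2, hk2, h3⟩ := h2
          rw [he h3] at hk2
          refine absurd (congrArg e (E.symm.injective (Subtype.ext (Prod.ext ?_ ?_)))) hm
          · exact hk1.trans hr.symm
          · exact hk2.trans hc.symm
        all_goals simp
      · simp
  have h1 := hasButterflyProduct_routeMatrix hp hM he r
  have h2 := hasButterflyProduct_diagonal hp d
  have h3 := (hasButterflyProduct_routeMatrix hp hM he c).transpose
  obtain ⟨L, h4, h5, h6⟩ := (h1.mul h2).mul h3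
  refine ⟨L, h4, h5.trans hprod, h6.trans ?_⟩
  have := Nat.mul_le_mul_left p hd
  linarith

/-! ### Embedding into larger matrices, and sums -/

/-- The zero-one matrix of a map. -/
noncomputable def inclusionMatrix {ι κ : Type*} [DecidableEq ι] (φ : κ → ι) : Matrix ι κ ℝ :=
  (1 : Matrix ι ι ℝ).submatrix id φ

theorem transpose_inclusionMatrix_mul {ι κ : Type*} [Fintype ι] [DecidableEq ι] (φ ψ : κ → ι) :
    (inclusionMatrix φ).transpose * inclusionMatrix ψ = (1 : Matrix ι ι ℝ).submatrix φ ψ := by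
  ext i j
  simp [inclusionMatrix, Matrix.mul_apply, Matrix.one_apply]

theorem inclusionMatrix_transpose_mul_self {ι κ : Type*} [Fintype ι] [DecidableEq ι]
    [DecidableEq κ] {φ : κ → ι} (hφ : Function.Injective φ) :
    (inclusionMatrix φ).transpose * inclusionMatrix φ = 1 := by
  rw [transpose_inclusionMatrix_mul, Matrix.submatrix_one _ hφ]

theorem inclusionMatrix_transpose_mul_of_disjoint {ι κ : Type*} [Fintype ι] [DecidableEq ι]
    {φ ψ : κ → ι} (h : ∀ i j, φ i ≠ ψ j) :
    (inclusionMatrix φ).transpose * inclusionMatrix ψ = 0 := by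
  rw [transpose_inclusionMatrix_mul]
  ext i j
  simp [h]

theorem submatrix_eq_inclusionMatrix_mul {ι κ : Type*} [Fintype ι] [DecidableEq ι] (φ : κ → ι)
    (X : Matrix ι ι ℝ) :
    X.submatrix φ φ = (inclusionMatrix φ).transpose * X * inclusionMatrix φ := by
  ext i j
  simp [inclusionMatrix, Matrix.mul_apply, Matrix.one_apply]

theorem matrixNnz_inclusionMatrix_mul_le {ι κ : Type*} [Fintype ι] [DecidableEq ι] [Fintype κ]
    (φ ψ : κ → ι) (M : Matrix κ κ ℝ) :
    matrixNnz (inclusionMatrix φ * M * (inclusionMatrix ψ).transpose) ≤ matrixNnz M := by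
  refine matrixNnz_le_of_support _
    (fun k : {e : κ × κ // M e.1 e.2 ≠ 0} => (φ k.1.1, ψ k.1.2)) fun r c h => ?_
  rw [Matrix.mul_apply] at h
  obtain ⟨j, -, hj⟩ := Finset.exists_ne_zero_of_sum_ne_zero h
  have hj1 := left_ne_zero_of_mul hj
  have hj2 := right_ne_zero_of_mul hj
  rw [Matrix.mul_apply] at hj1
  obtain ⟨i, -, hi⟩ := Finset.exists_ne_zero_of_sum_ne_zero hj1
  have hi1 := left_ne_zero_of_mul hi
  have hi2 := right_ne_zero_of_mul hi
  simp only [inclusionMatrix, Matrix.transpose_apply, Matrix.submatrix_apply, id,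
    Matrix.one_apply, ne_eq, ite_eq_right_iff, one_ne_zero, imp_false, not_not] at hj2 hi1
  exact ⟨⟨(i, j), hi2⟩, by rw [hi1, hj2]⟩

theorem matrixNnz_add_le {ι κ : Type*} [Fintype ι] [Fintype κ] (M N : Matrix ι κ ℝ) :
    matrixNnz (M + N) ≤ matrixNnz M + matrixNnz N := by
  have : matrixNnz M + matrixNnz N = Nat.card ({e : ι × κ // M e.1 e.2 ≠ 0} ⊕
      {e : ι × κ // N e.1 e.2 ≠ 0}) := Nat.card_sum.symm
  rw [this]
  refine matrixNnz_le_of_support _ (Sum.elim Subtype.val Subtype.val) fun r c h => ?_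
  by_cases hM : M r c = 0
  · by_cases hN : N r c = 0
    · simp [hM, hN] at h
    · exact ⟨Sum.inr ⟨(r, c), hN⟩, rfl⟩
  · exact ⟨Sum.inl ⟨(r, c), hM⟩, rfl⟩

theorem matrixNnz_one_le {κ : Type*} [Fintype κ] [DecidableEq κ] :
    matrixNnz (1 : Matrix κ κ ℝ) ≤ Fintype.card κ := by
  rw [← Nat.card_eq_fintype_card]
  refine matrixNnz_le_of_support _ (fun k => (k, k)) fun r c h => ⟨r, ?_⟩
  rw [Matrix.one_apply] at h
  split_ifs at h with hrc
  · rw [hrc]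
  · exact absurd rfl h

/-- A matrix is a sum of matrices with at most `d` nonzero entries each. -/
theorem exists_sum_of_matrixNnz {κ : Type*} [Fintype κ] (M : Matrix κ κ ℝ) {d : ℕ} (hd : 0 < d) :
    ∃ l : List (Matrix κ κ ℝ), l.length = matrixNnz M / d + 1 ∧ l.sum = M ∧
      ∀ N ∈ l, matrixNnz N ≤ d := by
  classical
  set s := matrixNnz M with hs
  let E : {e : κ × κ // M e.1 e.2 ≠ 0} ≃ Fin s := Finite.equivFinOfCardEq hs.symm
  -- The numbered entries are cut into consecutive runs of length `d`; the last piece is zero when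
  -- `d` divides `s`.
  let N : Fin (s / d + 1) → Matrix κ κ ℝ := fun i => Matrix.of fun r c =>
    if h : M r c ≠ 0 then if (E ⟨(r, c), h⟩ : ℕ) / d = i then M r c else 0 else 0
  refine ⟨List.ofFn N, by simp, ?_, ?_⟩
  · rw [List.sum_ofFn]
    ext r c
    rw [Matrix.sum_apply]
    simp only [N, Matrix.of_apply]
    by_cases h : M r c ≠ 0
    · simp only [dif_pos h]
      have hlt : (E ⟨(r, c), h⟩ : ℕ) / d < s / d + 1 :=
        Nat.lt_succ_of_le (Nat.div_le_div_right (E _).isLt.le)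
      rw [Finset.sum_eq_single ⟨_, hlt⟩]
      · simp
      · rintro i - hi
        exact if_neg fun hc => hi (Fin.ext hc.symm)
      · simp
    · simp only [dif_neg h]
      simpa using (not_not.mp h).symm
  · intro X hX
    obtain ⟨i, rfl⟩ := List.mem_ofFn.mp hX
    have hval : ∀ e : {e : κ × κ // N i e.1 e.2 ≠ 0}, ∃ h : M e.1.1 e.1.2 ≠ 0,
        (E ⟨e.1, h⟩ : ℕ) / d = i := by
      rintro ⟨⟨r, c⟩, he⟩
      simp only [N, Matrix.of_apply] at he
      split_ifs at he with h h'
      · exact ⟨h, h'⟩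
      all_goals exact absurd rfl he
    choose h hE using hval
    refine (Nat.card_le_card_of_injective
      (fun e => (⟨(E ⟨e.1, h e⟩ : ℕ) % d, Nat.mod_lt _ hd⟩ : Fin d)) fun e e' hee => ?_).trans
      (by simp)
    simp only [Fin.mk.injEq] at hee
    have h1 := Nat.div_add_mod (E ⟨e.1, h e⟩ : ℕ) d
    have h2 := Nat.div_add_mod (E ⟨e'.1, h e'⟩ : ℕ) d
    rw [hE, hee] at h1
    rw [hE, h1] at h2
    have h3 := E.injective (Fin.ext h2)
    simp only [Subtype.mk.injEq] at h3
    exact Subtype.ext h3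

/-- Products of unitriangular block matrices add up the blocks above the diagonal. -/
theorem exists_prod_eq_sum {ι κ : Type*} [Fintype ι] [DecidableEq ι] [Fintype κ] [DecidableEq κ]
    {J K : Matrix ι κ ℝ} (hJ : J.transpose * J = 1) (hK : K.transpose * K = 1)
    (hJK : J.transpose * K = 0) (hKJ : K.transpose * J = 0) (l : List (Matrix κ κ ℝ)) :
    (l.map fun M => J * J.transpose + K * K.transpose + J * M * K.transpose).prod *
      (K * J.transpose) = K * J.transpose + J * l.sum * J.transpose := by
  induction l with
  | nil => simp
  | cons M l ih =>
    have e1 : ∀ X : Matrix κ ι ℝ, J.transpose * (J * X) = X := fun X => by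
      rw [← Matrix.mul_assoc, hJ, Matrix.one_mul]
    have e2 : ∀ X : Matrix κ ι ℝ, K.transpose * (K * X) = X := fun X => by
      rw [← Matrix.mul_assoc, hK, Matrix.one_mul]
    have e3 : ∀ X : Matrix κ ι ℝ, J.transpose * (K * X) = 0 := fun X => by
      rw [← Matrix.mul_assoc, hJK, Matrix.zero_mul]
    have e4 : ∀ X : Matrix κ ι ℝ, K.transpose * (J * X) = 0 := fun X => by
      rw [← Matrix.mul_assoc, hKJ, Matrix.zero_mul]
    rw [List.map_cons, List.prod_cons, Matrix.mul_assoc, ih, List.sum_cons]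
    -- The first two summands preserve the `J` and `K` parts, and `J * M * K.transpose` turns `K *
    -- J.transpose` into the new term `J * M * J.transpose`.
    simp only [Matrix.add_mul, Matrix.mul_add, Matrix.mul_assoc, e1, e2, e3, e4, Matrix.mul_zero]
    abel

theorem HasButterflyProduct.list_prod {p b c N : ℕ}
    (l : List (Matrix (Fin (2 ^ p) × Fin b) (Fin (2 ^ p) × Fin b) ℝ))
    (h : ∀ M ∈ l, HasButterflyProduct c N M) :
    HasButterflyProduct (l.length * c) (l.length * N) l.prod := by
  induction l with
  | nil => exact ⟨[], by simp, by simp [blockButterflyProduct], by simp [numNonzeroParams]⟩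
  | cons M l ih =>
    have h1 := (h M (by simp)).mul (ih fun M' hM' => h M' (by simp [hM']))
    rw [List.prod_cons, List.length_cons, add_mul, add_mul, one_mul, one_mul, add_comm (_ * c),
      add_comm (_ * N)]
    exact h1

theorem numNonzeroParams_le_numParams {p b : ℕ}
    (L : List (Bool × (BlockButterflyIndex p b → ℝ))) : numNonzeroParams L ≤ numParams L := by
  rw [numNonzeroParams, numParams]
  refine (List.sum_le_card_nsmul _ (Fintype.card (BlockButterflyIndex p b)) fun x hx => ?_).trans
    (by simp)
  obtain ⟨e, -, rfl⟩ := List.mem_map.mp hx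
  rw [← Nat.card_eq_fintype_card]
  exact Finite.card_subtype_le _

/-- Few nonzero entries: nine factors. -/
theorem exists_butterflyProduct_of_le {n p b : ℕ} (hp : p ≠ 0) (hn : n ≤ 2 ^ p)
    (M : Matrix (Fin n × Fin b) (Fin n × Fin b) ℝ) (hM : matrixNnz M ≤ n * b) :
    ∃ L : List (Bool × (BlockButterflyIndex p b → ℝ)), L.length = 9 ∧
      numNonzeroParams L ≤ 9 * (p * matrixNnz M) ∧
      M = (blockButterflyProduct L).submatrix
        (Prod.map (Fin.castLE hn) id) (Prod.map (Fin.castLE hn) id) := by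
  have hφ : Function.Injective (Prod.map (Fin.castLE hn) (id : Fin b → Fin b)) :=
    (Fin.castLE_injective hn).prodMap Function.injective_id
  set J := inclusionMatrix (Prod.map (Fin.castLE hn) (id : Fin b → Fin b))
  have hJ := inclusionMatrix_transpose_mul_self hφ
  have h1 : matrixNnz (J * M * J.transpose) ≤ matrixNnz M := matrixNnz_inclusionMatrix_mul_le _ _ M
  obtain ⟨L, h2, h3, h4⟩ := hasButterflyProduct_of_matrixNnz_le hp (J * M * J.transpose)
    ((h1.trans hM).trans (Nat.mul_le_mul_right _ hn))
  refine ⟨L, h2, h4.trans (Nat.mul_le_mul_left _ (Nat.mul_le_mul_left _ h1)), ?_⟩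
  rw [submatrix_eq_inclusionMatrix_mul, h3]
  have e : J.transpose * (J * M * J.transpose) * J =
      (J.transpose * J) * M * (J.transpose * J) := by
    simp only [Matrix.mul_assoc]
  rw [e, hJ, Matrix.one_mul, Matrix.mul_one]

/-- Many nonzero entries: sums of pieces with few nonzero entries. -/
theorem exists_butterflyProduct {n p b : ℕ} (hp : p ≠ 0) (hnb : 0 < n * b) (hn : n ≤ 2 ^ p)
    (hn4 : 4 * n ≤ 2 ^ p) (M : Matrix (Fin n × Fin b) (Fin n × Fin b) ℝ) :
    ∃ L : List (Bool × (BlockButterflyIndex p b → ℝ)),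
      L.length = (matrixNnz M / (n * b) + 2) * 9 ∧
      M = (blockButterflyProduct L).submatrix
        (Prod.map (Fin.castLE hn) id) (Prod.map (Fin.castLE hn) id) := by
  -- A second copy of the index set, disjoint from the leading one.
  let sh : Fin n → Fin (2 ^ p) := fun i => ⟨i + n, by omega⟩
  have hφ : Function.Injective (Prod.map (Fin.castLE hn) (id : Fin b → Fin b)) :=
    (Fin.castLE_injective hn).prodMap Function.injective_id
  have hψ : Function.Injective (Prod.map sh (id : Fin b → Fin b)) :=
    Function.Injective.prodMap (fun i j h => by simpa [sh, Fin.ext_iff] using h)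
      Function.injective_id
  have hφψ : ∀ i j, Prod.map (Fin.castLE hn) (id : Fin b → Fin b) i ≠
      Prod.map sh (id : Fin b → Fin b) j := by
    intro i j h
    have := congrArg (fun z => (z.1 : ℕ)) h
    simp only [Prod.map_fst, Fin.val_castLE, sh] at this
    omega
  set J := inclusionMatrix (Prod.map (Fin.castLE hn) (id : Fin b → Fin b))
  set K := inclusionMatrix (Prod.map sh (id : Fin b → Fin b))
  have hJ : J.transpose * J = 1 := inclusionMatrix_transpose_mul_self hφ
  have hK : K.transpose * K = 1 := inclusionMatrix_transpose_mul_self hψ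
  have hJK : J.transpose * K = 0 := inclusionMatrix_transpose_mul_of_disjoint hφψ
  have hKJ : K.transpose * J = 0 :=
    inclusionMatrix_transpose_mul_of_disjoint fun i j h => hφψ j i h.symm
  obtain ⟨l, hl1, hl2, hl3⟩ := exists_sum_of_matrixNnz M hnb
  have hone : matrixNnz (1 : Matrix (Fin n × Fin b) (Fin n × Fin b) ℝ) ≤ n * b := by
    simpa using matrixNnz_one_le (κ := Fin n × Fin b)
  have hfour : 4 * (n * b) ≤ 2 ^ p * b := by
    rw [← mul_assoc]
    exact Nat.mul_le_mul_right _ hn4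
  have hid : ∀ φ ψ : Fin n × Fin b → Fin (2 ^ p) × Fin b,
      matrixNnz (inclusionMatrix φ * (inclusionMatrix ψ).transpose) ≤ n * b := fun φ ψ => by
    have := matrixNnz_inclusionMatrix_mul_le φ ψ 1
    rw [Matrix.mul_one] at this
    exact this.trans hone
  have hweak : ∀ X : Matrix (Fin (2 ^ p) × Fin b) (Fin (2 ^ p) × Fin b) ℝ,
      matrixNnz X ≤ 2 ^ p * b → HasButterflyProduct 9 (9 * (p * (2 ^ p * b))) X := by
    intro X hX
    obtain ⟨L, h1, h2, h3⟩ := hasButterflyProduct_of_matrixNnz_le hp X hX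
    exact ⟨L, h1, h2, h3.trans (Nat.mul_le_mul_left _ (Nat.mul_le_mul_left _ hX))⟩
  -- Each factor has at most `3 * (n * b)` nonzero entries, which fits since `4 * n ≤ 2 ^ p`. The
  -- identity on the two copies is used because the full identity would already exhaust the allowed
  -- `2 ^ p * b` entries.
  have h1 := HasButterflyProduct.list_prod
    (l.map fun N => J * J.transpose + K * K.transpose + J * N * K.transpose) (by
      intro X hX
      obtain ⟨N, hN, rfl⟩ := List.mem_map.mp hX
      apply hweak
      have h2 := matrixNnz_add_le (J * J.transpose + K * K.transpose) (J * N * K.transpose)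
      have h3 := matrixNnz_add_le (J * J.transpose) (K * K.transpose)
      have h4 : matrixNnz (J * J.transpose) ≤ n * b := hid _ _
      have h5 : matrixNnz (K * K.transpose) ≤ n * b := hid _ _
      have h6 : matrixNnz (J * N * K.transpose) ≤ matrixNnz N :=
        matrixNnz_inclusionMatrix_mul_le _ _ N
      have h7 := hl3 N hN
      omega)
  obtain ⟨L, hL1, hL2, -⟩ := h1.mul (hweak (K * J.transpose)
    ((show matrixNnz (K * J.transpose) ≤ n * b from hid _ _).trans (by omega)))
  refine ⟨L, ?_, ?_⟩
  · rw [hL1, List.length_map, hl1]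
    ring
  · rw [submatrix_eq_inclusionMatrix_mul, hL2, exists_prod_eq_sum hJ hK hJK hKJ, hl2]
    have e : J.transpose * (K * J.transpose + J * M * J.transpose) * J =
        (J.transpose * K) * (J.transpose * J) + (J.transpose * J) * M * (J.transpose * J) := by
      simp only [Matrix.mul_add, Matrix.add_mul, Matrix.mul_assoc]
    exact (by rw [e, hJ, hJK]; simp : J.transpose * (K * J.transpose + J * M * J.transpose) * J
      = M).symm

/-! ### Parameter counts and the choice of size -/

/-- From `8 * n ≤ n ^ 4` one gets `p * log 2 ≤ 4 * log n`, and `log 2 > 1 / 2`. -/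
theorem le_mul_log_of_two_pow_le {n p : ℕ} (hn : 2 ≤ n) (hp : 2 ^ p ≤ 8 * n) :
    (p : ℝ) ≤ 8 * Real.log n := by
  have h1 : ((2 : ℝ) ^ p) ≤ (n : ℝ) ^ 4 := by
    have : 2 ^ p ≤ n ^ 4 := hp.trans (by
      calc 8 * n = 2 ^ 3 * n := by norm_num
        _ ≤ n ^ 3 * n := Nat.mul_le_mul_right _ (Nat.pow_le_pow_left hn 3)
        _ = n ^ 4 := by ring)
    exact_mod_cast this
  have h2 := Real.log_le_log (by positivity) h1
  rw [Real.log_pow, Real.log_pow] at h2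
  have h3 := Real.log_two_gt_d9
  push_cast at h2
  nlinarith [(Nat.cast_nonneg p : (0 : ℝ) ≤ p)]

/-- The constant is `128 = 2 * 8 * 8`, from `2 ^ (p + 1) = 2 * 2 ^ p`, `2 ^ p ≤ 8 * n` and `p ≤ 8 *
log n`. -/
theorem numParams_le {n p b : ℕ} (hn : 2 ≤ n) (hp : 2 ^ p ≤ 8 * n)
    (L : List (Bool × (BlockButterflyIndex p b → ℝ))) :
    (numParams L : ℝ) ≤ 128 * b ^ 2 * (L.length * n) * Real.log n := by
  have h1 := le_mul_log_of_two_pow_le hn hp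
  have h2 : ((2 : ℝ) ^ p) ≤ 8 * n := by exact_mod_cast hp
  rw [numParams, card_blockButterflyIndex]
  push_cast
  have h3 : (p : ℝ) * 2 ^ p ≤ 8 * Real.log n * (8 * n) :=
    mul_le_mul h1 h2 (by positivity) (by
      have := Real.log_natCast_nonneg n
      positivity)
  calc (L.length : ℝ) * (p * (2 ^ (p + 1) * b ^ 2))
      = (2 * L.length * b ^ 2) * (p * 2 ^ p) := by ring
    _ ≤ (2 * L.length * b ^ 2) * (8 * Real.log n * (8 * n)) :=
        mul_le_mul_of_nonneg_left h3 (by positivity)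
    _ = _ := by ring

theorem mainTheorem2 (b : ℕ) (hb : ∃ q : ℕ, b = 2 ^ q) :
    ∃ C : ℝ, ∀ (n s : ℕ) (M : Matrix (Fin n × Fin b) (Fin n × Fin b) ℝ),
      2 ≤ n → matrixNnz M = s →
      ∃ (p : ℕ) (hp : n ≤ 2 ^ p) (L : List (Bool × (BlockButterflyIndex p b → ℝ))),
        2 ^ p ≤ 8 * n ∧
        ((∃ q : ℕ, n = 2 ^ q) → s ≤ n * b → 2 ^ p = n) ∧
        M = (blockButterflyProduct L).submatrix
              (Prod.map (Fin.castLE hp) id) (Prod.map (Fin.castLE hp) id) ∧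
        (numParams L : ℝ) ≤ C * (max s n : ℕ) * Real.log n ∧
        (numNonzeroParams L : ℝ) ≤ C * s * Real.log n := by
  have hb1 : 1 ≤ b := by
    obtain ⟨q, rfl⟩ := hb
    exact Nat.one_le_two_pow
  have hb2 : (1 : ℝ) ≤ (b : ℝ) ^ 2 := one_le_pow₀ (by exact_mod_cast hb1)
  -- The 128 comes from `numParams_le`. The 27 bounds `9 * (s / (n * b) + 2) * n ≤ 9 * (s + 2 * n) ≤
  -- 27 * s` for `n ≤ s`, and covers the 9 factors of the sparse case.
  refine ⟨128 * 27 * b ^ 2, fun n s M hn hs => ?_⟩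
  have hlog := Real.log_natCast_nonneg n
  have hclog : ∀ k, 2 ≤ k → k ≤ 2 ^ Nat.clog 2 k ∧ 2 ^ Nat.clog 2 k ≤ 2 * k ∧
      Nat.clog 2 k ≠ 0 := by
    intro k hk
    have h0 : Nat.clog 2 k ≠ 0 := (Nat.clog_pos (by norm_num) hk).ne'
    refine ⟨Nat.le_pow_clog (by norm_num) k, ?_, h0⟩
    have h1 := Nat.pow_pred_clog_lt_self (b := 2) (by norm_num) (show 1 < k from hk)
    obtain ⟨q, hq⟩ := Nat.exists_eq_succ_of_ne_zero h0
    rw [hq] at h1 ⊢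
    rw [Nat.pred_succ] at h1
    rw [pow_succ]
    omega
  rcases le_or_gt s (n * b) with hsn | hsn
  · obtain ⟨h1, h2, h3⟩ := hclog n hn
    obtain ⟨L, hL, hL1, hL2⟩ := exists_butterflyProduct_of_le h3 h1 M (hs.trans_le hsn)
    have h8 : 2 ^ Nat.clog 2 n ≤ 8 * n := by omega
    refine ⟨Nat.clog 2 n, h1, L, h8, ?_, hL2, ?_, ?_⟩
    · rintro ⟨q, rfl⟩ -
      rw [Nat.clog_pow _ _ (by norm_num)]
    · refine (numParams_le hn h8 L).trans (mul_le_mul_of_nonneg_right ?_ hlog)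
      have : (n : ℝ) ≤ (max s n : ℕ) := by exact_mod_cast le_max_right s n
      rw [hL]
      push_cast at this ⊢
      nlinarith
    · have h4 := le_mul_log_of_two_pow_le hn h8
      rw [hs] at hL1
      calc (numNonzeroParams L : ℝ) ≤ 9 * (Nat.clog 2 n * s) := by exact_mod_cast hL1
        _ ≤ 9 * (8 * Real.log n * s) := by gcongr
        _ ≤ 128 * 27 * 1 * s * Real.log n := by
          have : 0 ≤ (s : ℝ) * Real.log n := by positivity
          linarith
        _ ≤ 128 * 27 * b ^ 2 * s * Real.log n := by gcongr
  -- Rounding up `4 * n` makes room for the unitriangular factors and still gives at most `8 * n`.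
  -- Since `n ≤ s` here, the count of all parameters also bounds the nonzero ones.
  · obtain ⟨h1, h2, h3⟩ := hclog (4 * n) (by omega)
    have hnp : n ≤ 2 ^ Nat.clog 2 (4 * n) := by omega
    have h8 : 2 ^ Nat.clog 2 (4 * n) ≤ 8 * n := by omega
    obtain ⟨L, hL, hL2⟩ := exists_butterflyProduct h3 (Nat.mul_pos (by omega) hb1) hnp h1 M
    have hns : n ≤ s := (Nat.le_mul_of_pos_right n hb1).trans hsn.le
    have hlen : L.length * n ≤ 27 * s := by
      have h4 : s / (n * b) * n ≤ s :=
        (Nat.mul_le_mul_left _ (Nat.le_mul_of_pos_right n hb1)).trans (Nat.div_mul_le_self _ _)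
      rw [hL, hs]
      linarith
    have hpar : (numParams L : ℝ) ≤ 128 * 27 * b ^ 2 * s * Real.log n := by
      refine (numParams_le hn h8 L).trans (mul_le_mul_of_nonneg_right ?_ hlog)
      have : ((L.length : ℝ) * n) ≤ 27 * s := by exact_mod_cast hlen
      nlinarith
    refine ⟨_, hnp, L, h8, fun _ h => absurd h (not_le.mpr hsn), hL2, ?_, ?_⟩
    · rwa [max_eq_left hns]
    · exact le_trans (by exact_mod_cast numNonzeroParams_le_numParams L) hpar
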